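/- Let $G$ be a group with an Abelian subgroup $\Gamma$ of finite index $k=[G:\Gamma]<\infty$, and let $\pi\colon G\to U(d)$ be a unitary representation (a group homomorphism into the group of unitary $d\times d$ complex matrices). Let $g_d$ be a random $d\times d$ matrix, defined on some probability space, whose entries $g_d(i,j)$ are i.i.d. (circularly symmetric, centred) complex Gaussian random variables with $\mathbb E|g_d(i,j)|^2=1/d$; that is, the real and imaginary parts of each entry are independent centred real Gaussian variables of variance $1/(2d)$. Then $\sup_{t\in G}|\mathrm{tr}(g_d\pi(t))|$ is finite everywhere and integrable, and $$\mathbb E\,\sup_{t\in G}|\mathrm{tr}(g_d\,\pi(t))|\;\le\;\sqrt{2\log k}+\sqrt d .$$ -/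

import Mathlib

open MeasureTheory ProbabilityTheory
open scoped NNReal

/-- The centred, circularly symmetric complex Gaussian law on `ℂ` with `E|z|² = v`: the real and
imaginary parts are independent real centred Gaussians, each of variance `v / 2`. -/
noncomputable def complexGaussian (v : ℝ≥0) : Measure ℂ :=
  ((gaussianReal 0 (v / 2)).prod (gaussianReal 0 (v / 2))).map
    (fun p : ℝ × ℝ => (⟨p.1, p.2⟩ : ℂ))

/-- `g` is a normalized complex Gaussian random `d × d` matrix on `(Ω, P)`: its entries are
i.i.d. complex Gaussian variables with `E|g(i,j)|² = 1 / d`. -/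
structure IsNormalizedGaussianMatrix {Ω : Type*} [MeasurableSpace Ω] (P : Measure Ω)
    (d : ℕ) (g : Ω → Matrix (Fin d) (Fin d) ℂ) : Prop where
  indep : iIndepFun (fun (p : Fin d × Fin d) (ω : Ω) => g ω p.1 p.2) P
  law : ∀ i j : Fin d, HasLaw (fun ω => g ω i j) (complexGaussian (1 / (d : ℝ≥0))) P

/-!
On the abelian subgroup `Γ` the representation is diagonal in a suitable orthonormal basis `V`. Hence,
as `t` runs over one coset of `Γ`, `tr (g π(t)) = ∑ i, c i * Y i` where only the unimodular factors
`c i` depend on `t`: here `Y i = (V⁻¹ g W V) i i`, with `W` the value of `π` at a representative of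
the coset. So `|tr (g π(t))| ≤ ∑ i, |Y i|` (`exists_orthonormal_norm_trace_le`), and the supremum
over `G` is bounded by a maximum of `k` such sums, one for each coset.

For a fixed coset the `Y i` are orthonormal linear combinations of the entries of `g`, hence i.i.d.
complex Gaussians with `E|Y i|² = 1 / d` (`hasLaw_pi_complexGaussian_of_orthonormal`), and their
moduli satisfy `E exp (l |Y i|) ≤ exp (l / √d + l² / (2 d))`
(`integral_exp_mul_norm_complexGaussian_le`). By independence
`E exp (l ∑ i, |Y i|) ≤ exp (l √d + l² / 2)`. The usual bound for the expected maximum of `k`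
variables (`mul_integral_le_log_card_add`) gives `l E sup ≤ log k + l √d + l² / 2` for all `l > 0`,
and the optimal `l` is `√(2 log k)`. The joint law over different
cosets plays no role.
-/

/-! ### The complex Gaussian law -/

theorem charFun_complexGaussian (v : ℝ≥0) (t : ℂ) :
    charFun (complexGaussian v) t = Complex.exp (-(v * ‖t‖ ^ 2 / 4 : ℝ)) := by
  have hm : Measurable (fun p : ℝ × ℝ => (⟨p.1, p.2⟩ : ℂ)) :=
    Complex.measurableEquivRealProd.symm.measurable
  rw [charFun_apply, complexGaussian, integral_map hm.aemeasurable (by fun_prop)]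
  have h : ∀ p : ℝ × ℝ, Complex.exp ((inner ℝ (⟨p.1, p.2⟩ : ℂ) t : ℝ) * Complex.I) =
      Complex.exp ((inner ℝ p.1 t.re : ℝ) * Complex.I) *
        Complex.exp ((inner ℝ p.2 t.im : ℝ) * Complex.I) := by
    intro p
    rw [← Complex.exp_add, ← add_mul, ← Complex.ofReal_add]
    simp [Complex.inner]
  simp_rw [h]
  rw [integral_prod_mul (fun x : ℝ => Complex.exp ((inner ℝ x t.re : ℝ) * Complex.I))
    (fun x : ℝ => Complex.exp ((inner ℝ x t.im : ℝ) * Complex.I)), ← charFun_apply,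
    ← charFun_apply, charFun_gaussianReal, charFun_gaussianReal, ← Complex.exp_add,
    Complex.sq_norm, Complex.normSq_apply]
  congr 1
  push_cast
  ring

instance isProbabilityMeasure_complexGaussian (v : ℝ≥0) :
    IsProbabilityMeasure (complexGaussian v) :=
  Measure.isProbabilityMeasure_map
    Complex.measurableEquivRealProd.symm.measurable.aemeasurable

theorem integral_exp_mul_sq_gaussianReal {v : ℝ≥0} (hv : v ≠ 0) {s : ℝ} (hs : 2 * s * v < 1) :
    ∫ x, Real.exp (s * x ^ 2) ∂(gaussianReal 0 v) = (√(1 - 2 * s * v))⁻¹ := by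
  have hv' : (0 : ℝ) < v := by positivity
  have h : ∀ x : ℝ, gaussianPDFReal 0 v x • Real.exp (s * x ^ 2) =
      (√(2 * Real.pi * v))⁻¹ * Real.exp (-((1 - 2 * s * v) / (2 * v)) * x ^ 2) := by
    intro x
    rw [gaussianPDFReal, smul_eq_mul, mul_assoc, ← Real.exp_add]
    congr 2
    field_simp
    ring
  rw [integral_gaussianReal_eq_integral_smul hv]
  simp_rw [h]
  rw [integral_const_mul, integral_gaussian, ← Real.sqrt_inv, ← Real.sqrt_inv,
    ← Real.sqrt_mul (by positivity)]
  congr 1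
  have : 1 - 2 * s * v ≠ 0 := by linarith
  field_simp

theorem integral_exp_mul_norm_sq_complexGaussian {v : ℝ≥0} (hv : v ≠ 0) {s : ℝ}
    (hs : s * v < 1) :
    ∫ z, Real.exp (s * ‖z‖ ^ 2) ∂(complexGaussian v) = (1 - s * v)⁻¹ := by
  have hm : Measurable (fun p : ℝ × ℝ => (⟨p.1, p.2⟩ : ℂ)) :=
    Complex.measurableEquivRealProd.symm.measurable
  rw [complexGaussian, integral_map hm.aemeasurable (by fun_prop)]
  have h : ∀ p : ℝ × ℝ, Real.exp (s * ‖(⟨p.1, p.2⟩ : ℂ)‖ ^ 2) =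
      Real.exp (s * p.1 ^ 2) * Real.exp (s * p.2 ^ 2) := by
    intro p
    rw [← Real.exp_add, Complex.sq_norm, Complex.normSq_apply]
    ring_nf
  have hs' : 2 * s * (v / 2 : ℝ≥0) < 1 := by push_cast; linarith
  simp_rw [h]
  rw [integral_prod_mul (fun x : ℝ => Real.exp (s * x ^ 2)) (fun x : ℝ => Real.exp (s * x ^ 2)),
    integral_exp_mul_sq_gaussianReal (by positivity) hs', ← mul_inv,
    Real.mul_self_sqrt (by linarith)]
  push_cast
  ring_nf

theorem integrable_exp_mul_norm_sq_complexGaussian {v : ℝ≥0} (hv : v ≠ 0) {s : ℝ}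
    (hs : s * v < 1) : Integrable (fun z => Real.exp (s * ‖z‖ ^ 2)) (complexGaussian v) := by
  refine Integrable.of_integral_ne_zero ?_
  rw [integral_exp_mul_norm_sq_complexGaussian hv hs]
  exact inv_ne_zero (by linarith)

theorem integrable_exp_mul_norm_complexGaussian {v : ℝ≥0} (hv : v ≠ 0) (l : ℝ) :
    Integrable (fun z => Real.exp (l * ‖z‖)) (complexGaussian v) := by
  have hv' : (0 : ℝ) < v := by positivity
  have hs : 1 / (2 * v) * v < (1 : ℝ) := by field_simp; norm_num
  refine ((integrable_exp_mul_norm_sq_complexGaussian hv hs).const_mul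
    (Real.exp (l ^ 2 * v / 2))).mono' (by fun_prop) (ae_of_all _ fun z => ?_)
  rw [Real.norm_eq_abs, Real.abs_exp, ← Real.exp_add, Real.exp_le_exp]
  have : l ^ 2 * v / 2 + 1 / (2 * v) * ‖z‖ ^ 2 - l * ‖z‖ = (l * v - ‖z‖) ^ 2 / (2 * v) := by
    field_simp
    ring
  have h2 : 0 ≤ (l * v - ‖z‖) ^ 2 / (2 * v) := by positivity
  linarith

/-- The exponential moment of a Rayleigh variable. The right-hand side is that of a variable of mean
`√v` with sub-Gaussian variance `v`; both constants are larger than the true ones (the mean of `‖z‖`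
is `√(π v) / 2`), which leaves room for a proof by the quadratic bound `l ‖z‖ ≤ c ‖z‖² + l² / (4 c)`
alone. -/
theorem integral_exp_mul_norm_complexGaussian_le {v : ℝ≥0} (hv : v ≠ 0) {l : ℝ} (hl : 0 ≤ l) :
    ∫ z, Real.exp (l * ‖z‖) ∂(complexGaussian v) ≤ Real.exp (l * √v + l ^ 2 * v / 2) := by
  have hv' : (0 : ℝ) < v := by positivity
  obtain ⟨r, hr, hrv⟩ : ∃ r : ℝ, 0 < r ∧ (v : ℝ) = r ^ 2 :=
    ⟨√v, Real.sqrt_pos.2 hv', (Real.sq_sqrt hv'.le).symm⟩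
  have key : ∀ c : ℝ, 0 < c → c * v < 1 → ∫ z, Real.exp (l * ‖z‖) ∂(complexGaussian v) ≤
      Real.exp (l ^ 2 / (4 * c)) * (1 - c * v)⁻¹ := by
    intro c hc hcv
    rw [← integral_exp_mul_norm_sq_complexGaussian hv hcv, ← integral_const_mul]
    refine integral_mono (integrable_exp_mul_norm_complexGaussian hv l)
      ((integrable_exp_mul_norm_sq_complexGaussian hv hcv).const_mul _) fun z => ?_
    dsimp only
    rw [← Real.exp_add, Real.exp_le_exp]
    have : l ^ 2 / (4 * c) + c * ‖z‖ ^ 2 - l * ‖z‖ = (l - 2 * c * ‖z‖) ^ 2 / (4 * c) := by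
      field_simp
      ring
    have h2 : 0 ≤ (l - 2 * c * ‖z‖) ^ 2 / (4 * c) := by positivity
    linarith
  rw [hrv, Real.sqrt_sq hr.le]
  rcases hl.eq_or_lt with rfl | hl
  · simp
  rcases le_or_gt (l * r) 1 with h | h
  -- With `m = l r ≤ 1`, the choice `c = l / (2 r)` gives `exp (m / 2) / (1 - m / 2)`, and
  -- `1 / (1 - m / 2) ≤ 1 + m / 2 + m ^ 2 / 2`.
  · refine (key (l / (2 * r)) (by positivity) ?_).trans ?_
    · rw [hrv]
      field_simp
      linarith
    · have e1 : l ^ 2 / (4 * (l / (2 * r))) = l * r / 2 := by field_simp; ring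
      have e2 : l / (2 * r) * v = l * r / 2 := by rw [hrv]; field_simp
      have e3 : l * r + l ^ 2 * r ^ 2 / 2 = l * r / 2 + (l * r / 2 + (l * r) ^ 2 / 2) := by ring
      rw [e1, e2, e3, Real.exp_add (l * r / 2)]
      gcongr
      refine le_trans ?_ (Real.add_one_le_exp _)
      have : 0 < l * r := by positivity
      rw [inv_le_iff_one_le_mul₀ (by linarith)]
      nlinarith [sq_nonneg (l * r), mul_nonneg (sq_nonneg (l * r)) (sub_nonneg.2 h)]
  -- For `l r > 1`, the choice `c v = 1 / 2` gives `2 exp (l² r² / 2)`, and `2 ≤ exp (l r)`.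
  · refine (key (1 / (2 * r ^ 2)) (by positivity) ?_).trans ?_
    · rw [hrv]
      field_simp
      norm_num
    · have e1 : l ^ 2 / (4 * (1 / (2 * r ^ 2))) = l ^ 2 * r ^ 2 / 2 := by field_simp; norm_num
      have e2 : (1 - 1 / (2 * r ^ 2) * v : ℝ)⁻¹ = 2 := by rw [hrv]; field_simp; norm_num
      rw [e1, e2, add_comm, Real.exp_add]
      gcongr
      linarith [Real.add_one_le_exp (l * r)]

/-! ### Unitary invariance and sums of moduli -/

/-- Unitary invariance of the complex Gaussian law: orthonormal linear combinations of i.i.d. complex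
Gaussian variables are again i.i.d. with the same law. -/
theorem hasLaw_pi_complexGaussian_of_orthonormal {Ω ι κ : Type*} [MeasurableSpace Ω]
    [Fintype ι] [DecidableEq ι] [Fintype κ] {P : Measure Ω} [IsProbabilityMeasure P] {v : ℝ≥0}
    {Z : κ → Ω → ℂ} (hZ : iIndepFun Z P) (hlaw : ∀ p, HasLaw (Z p) (complexGaussian v) P)
    {a : ι → κ → ℂ} (ha : ∀ i j, ∑ p, a i p * star (a j p) = if i = j then 1 else 0) :
    HasLaw (fun ω i => ∑ p, a i p * Z p ω) (Measure.pi fun _ => complexGaussian v) P := by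
  have hZm : ∀ p, AEMeasurable (Z p) P := fun p => (hlaw p).aemeasurable
  have hY : AEMeasurable (fun ω i => ∑ p, a i p * Z p ω) P := by fun_prop
  refine ⟨hY, ?_⟩
  -- Characteristic functions live on the Euclidean space `PiLp 2`, so both laws are moved there.
  refine (MeasurableEquiv.toLp 2 (ι → ℂ)).map_measurableEquiv_injective ?_
  change (P.map _).map (WithLp.toLp 2) = (Measure.pi _).map (WithLp.toLp 2)
  have hmeas : Measurable (WithLp.toLp 2 : (ι → ℂ) → EuclideanSpace ℂ ι) := by fun_prop
  have : IsProbabilityMeasure (P.map (fun ω i => ∑ p, a i p * Z p ω)) :=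
    Measure.isProbabilityMeasure_map hY
  have : IsProbabilityMeasure ((P.map (fun ω i => ∑ p, a i p * Z p ω)).map
      (WithLp.toLp 2 : (ι → ℂ) → EuclideanSpace ℂ ι)) :=
    Measure.isProbabilityMeasure_map hmeas.aemeasurable
  have : IsProbabilityMeasure ((Measure.pi fun _ : ι => complexGaussian v).map
      (WithLp.toLp 2 : (ι → ℂ) → EuclideanSpace ℂ ι)) :=
    Measure.isProbabilityMeasure_map hmeas.aemeasurable
  refine Measure.ext_of_charFun (E := PiLp 2 fun _ : ι => ℂ) (funext fun t => ?_)
  rw [charFun_pi, charFun_apply, integral_map hmeas.aemeasurable (by fun_prop),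
    integral_map hY (by fun_prop)]
  simp_rw [charFun_complexGaussian]
  -- `c` is the image of `t` under the adjoint of the isometry with rows `a i`.
  set c : κ → ℂ := fun p => ∑ i, star (a i p) * t i with hc
  have hinner : ∀ ω, inner ℝ (WithLp.toLp 2 (fun i => ∑ p, a i p * Z p ω) :
      PiLp 2 fun _ : ι => ℂ) t = ∑ p, inner ℝ (Z p ω) (c p) := by
    intro ω
    simp only [PiLp.inner_apply, sum_inner, hc, inner_sum]
    rw [Finset.sum_comm]
    refine Finset.sum_congr rfl fun p _ => Finset.sum_congr rfl fun i _ => ?_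
    simp only [Complex.inner, map_mul]
    congr 1
    simp only [RCLike.star_def]
    ring
  have hexp : ∀ ω, Complex.exp ((inner ℝ (WithLp.toLp 2 (fun i => ∑ p, a i p * Z p ω) :
      PiLp 2 fun _ : ι => ℂ) t : ℝ) * Complex.I) =
      ∏ p, Complex.exp ((inner ℝ (Z p ω) (c p) : ℝ) * Complex.I) := by
    intro ω
    rw [hinner, ← Complex.exp_sum, Complex.ofReal_sum, Finset.sum_mul]
  have hfac : ∀ p, Continuous fun z : ℂ => Complex.exp ((inner ℝ z (c p) : ℝ) * Complex.I) :=
    fun p => by fun_prop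
  have hnorm : ∑ p, ‖c p‖ ^ 2 = ∑ i, ‖t i‖ ^ 2 := by
    have : ((∑ p, ‖c p‖ ^ 2 : ℝ) : ℂ) = ((∑ i, ‖t i‖ ^ 2 : ℝ) : ℂ) := by
      push_cast
      simp_rw [← Complex.mul_conj']
      have e : ∀ p, c p * (starRingEnd ℂ) (c p) =
          ∑ i, ∑ j, t i * star (t j) * (a j p * star (a i p)) := by
        intro p
        simp only [hc, map_sum, Finset.sum_mul_sum]
        refine Finset.sum_congr rfl fun i _ => Finset.sum_congr rfl fun j _ => ?_
        simp
        ring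
      simp_rw [e]
      rw [Finset.sum_comm]
      refine Finset.sum_congr rfl fun i _ => ?_
      rw [Finset.sum_comm]
      simp_rw [← Finset.mul_sum, ha]
      simp
    exact_mod_cast this
  simp_rw [hexp]
  rw [(hZ.comp _ fun p => (hfac p).measurable).integral_fun_prod_eq_prod_integral
    (X := fun p ω => Complex.exp ((inner ℝ (Z p ω) (c p) : ℝ) * Complex.I))
    fun p => ((hfac p).measurable.comp_aemeasurable (hZm p)).aestronglyMeasurable]
  have hint : ∀ p, ∫ ω, Complex.exp ((inner ℝ (Z p ω) (c p) : ℝ) * Complex.I) ∂P =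
      Complex.exp (-(v * ‖c p‖ ^ 2 / 4 : ℝ)) := by
    intro p
    rw [← charFun_complexGaussian, charFun_apply, ← (hlaw p).map_eq,
      integral_map (hZm p) (by fun_prop)]
  simp_rw [hint]
  rw [← Complex.exp_sum, ← Complex.exp_sum]
  congr 1
  have := congrArg (fun x : ℝ => -(v * x / 4)) hnorm
  simp only [Finset.mul_sum, Finset.sum_div, ← Finset.sum_neg_distrib] at this
  exact_mod_cast this

theorem exp_sum_norm_pi_complexGaussian {ι : Type*} [Fintype ι] {v : ℝ≥0} (hv : v ≠ 0)
    {l : ℝ} (hl : 0 ≤ l) :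
    Integrable (fun z : ι → ℂ => Real.exp (l * ∑ i, ‖z i‖))
        (Measure.pi fun _ => complexGaussian v) ∧
      ∫ z : ι → ℂ, Real.exp (l * ∑ i, ‖z i‖) ∂(Measure.pi fun _ => complexGaussian v) ≤
        Real.exp (Fintype.card ι * (l * √v + l ^ 2 * v / 2)) := by
  have h : ∀ z : ι → ℂ, Real.exp (l * ∑ i, ‖z i‖) = ∏ i, Real.exp (l * ‖z i‖) := by
    intro z
    rw [Finset.mul_sum, Real.exp_sum]
  simp_rw [h]
  refine ⟨Integrable.fintype_prod (f := fun _ z => Real.exp (l * ‖z‖))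
    fun _ => integrable_exp_mul_norm_complexGaussian hv l, ?_⟩
  rw [integral_fintype_prod_eq_prod (fun _ z => Real.exp (l * ‖z‖)), Finset.prod_const,
    Finset.card_univ, Real.exp_nat_mul]
  exact pow_le_pow_left₀ (integral_nonneg fun z => (Real.exp_pos _).le)
    (integral_exp_mul_norm_complexGaussian_le hv hl) _

/-! ### From exponential moments to the expected maximum -/

/-- The expectation of a maximum of `card J` variables in terms of a common bound on their
exponential moments. The tangent bound `x ≤ a - 1 + exp (x - a)` at the final value `a` takes the
place of Jensen's inequality. -/
theorem mul_integral_le_log_card_add {Ω J : Type*} [MeasurableSpace Ω] [Fintype J] [Nonempty J]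
    {P : Measure Ω} [IsProbabilityMeasure P] {S : Ω → ℝ} {F : J → Ω → ℝ} {l b : ℝ}
    (hS : Integrable S P) (hSF : ∀ ω, ∃ j, l * S ω ≤ F j ω)
    (hF : ∀ j, Integrable (fun ω => Real.exp (F j ω)) P)
    (hb : ∀ j, ∫ ω, Real.exp (F j ω) ∂P ≤ Real.exp b) :
    l * ∫ ω, S ω ∂P ≤ Real.log (Fintype.card J) + b := by
  have hcard : (0 : ℝ) < Fintype.card J := by exact_mod_cast Fintype.card_pos
  set a := Real.log (Fintype.card J) + b with ha
  have hpt : ∀ ω, l * S ω ≤ (a - 1) + Real.exp (-a) * ∑ j, Real.exp (F j ω) := by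
    intro ω
    obtain ⟨j, hj⟩ := hSF ω
    have h1 := Real.add_one_le_exp (F j ω - a)
    have h2 : Real.exp (F j ω - a) ≤ Real.exp (-a) * ∑ j, Real.exp (F j ω) := by
      rw [sub_eq_add_neg, add_comm, Real.exp_add]
      gcongr
      exact Finset.single_le_sum (f := fun j => Real.exp (F j ω))
        (fun i _ => (Real.exp_pos _).le) (Finset.mem_univ j)
    linarith
  have hint : Integrable (fun ω => ∑ j, Real.exp (F j ω)) P :=
    integrable_finsetSum _ fun j _ => hF j
  have hsum : ∑ j, ∫ ω, Real.exp (F j ω) ∂P ≤ Real.exp a := by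
    rw [ha, Real.exp_add, Real.exp_log hcard]
    simpa using Finset.sum_le_card_nsmul Finset.univ _ _ fun j _ => hb j
  calc l * ∫ ω, S ω ∂P = ∫ ω, l * S ω ∂P := (integral_const_mul _ _).symm
    _ ≤ ∫ ω, ((a - 1) + Real.exp (-a) * ∑ j, Real.exp (F j ω)) ∂P :=
        integral_mono (hS.const_mul l) ((integrable_const _).add (hint.const_mul _)) hpt
    _ = (a - 1) + Real.exp (-a) * ∑ j, ∫ ω, Real.exp (F j ω) ∂P := by
        rw [integral_add (integrable_const _) (hint.const_mul _), integral_const_mul,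
          integral_finsetSum _ fun j _ => hF j]
        simp
    _ ≤ (a - 1) + Real.exp (-a) * Real.exp a := by gcongr
    _ = a := by rw [← Real.exp_add]; simp

/-- Optimization over `l`: the minimum is at `l = √(2 L)` for `L > 0`, and is only approached as
`l → 0` for `L = 0`. -/
theorem le_sqrt_two_mul_add_of_forall_mul_le {x y L : ℝ} (hL : 0 ≤ L)
    (h : ∀ l : ℝ, 0 < l → l * x ≤ L + (l * y + l ^ 2 / 2)) : x ≤ √(2 * L) + y := by
  rcases hL.eq_or_lt with rfl | hL
  · refine le_of_forall_pos_le_add fun ε hε => ?_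
    have h1 := h (2 * ε) (by positivity)
    have h2 : (2 * ε) * x ≤ (2 * ε) * (y + ε) := by linarith
    have h3 := le_of_mul_le_mul_left h2 (by positivity)
    simpa using h3
  · have hs : 0 < √(2 * L) := Real.sqrt_pos.2 (by positivity)
    have h1 := h _ hs
    have h2 := Real.sq_sqrt (show 0 ≤ 2 * L by positivity)
    refine le_of_mul_le_mul_left (a := √(2 * L)) ?_ hs
    nlinarith

/-! ### Restriction to an abelian subgroup -/

/-- A commuting family of unitary matrices is simultaneously diagonalized by a unitary matrix. -/
theorem exists_unitary_diagonalizing {α : Type*} {d : ℕ}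
    (U : α → Matrix.unitaryGroup (Fin d) ℂ) (hU : ∀ a b, Commute (U a) (U b)) :
    ∃ V : Matrix.unitaryGroup (Fin d) ℂ, ∀ a, ∃ c : Fin d → ℂ, (∀ i, ‖c i‖ = 1) ∧
      (U a : Matrix (Fin d) (Fin d) ℂ) * V = V * Matrix.diagonal c := by
  classical
  -- Mathlib diagonalizes commuting symmetric operators, so `U a` is replaced by the two Hermitian
  -- matrices `U a + (U a)⁻¹` and `i (U a - (U a)⁻¹)`, of which it is a linear combination.
  let H : α × Bool → Matrix (Fin d) (Fin d) ℂ := fun p =>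
    if p.2 then (U p.1 : Matrix (Fin d) (Fin d) ℂ) + star (U p.1 : Matrix (Fin d) (Fin d) ℂ)
    else Complex.I • ((U p.1 : Matrix (Fin d) (Fin d) ℂ) - star (U p.1 : Matrix (Fin d) (Fin d) ℂ))
  let T : α × Bool → EuclideanSpace ℂ (Fin d) →ₗ[ℂ] EuclideanSpace ℂ (Fin d) :=
    fun p => Matrix.toEuclideanLin (H p)
  have hT : ∀ p, (T p).IsSymmetric := by
    rintro ⟨a, b⟩
    rw [Matrix.isSymmetric_toEuclideanLin_iff]
    change star (H (a, b)) = H (a, b)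
    cases b
    · simp [H, smul_sub]
      abel
    · simp [H, add_comm]
  have hcomm : ∀ p q, Commute (H p) (H q) := by
    have h1 : ∀ a b, Commute (U a : Matrix (Fin d) (Fin d) ℂ) (U b) := fun a b =>
      congrArg (fun u : Matrix.unitaryGroup (Fin d) ℂ => (u : Matrix (Fin d) (Fin d) ℂ)) (hU a b)
    have h2 : ∀ a b, Commute (U a : Matrix (Fin d) (Fin d) ℂ)
        (star (U b : Matrix (Fin d) (Fin d) ℂ)) := fun a b =>
      congrArg (fun u : Matrix.unitaryGroup (Fin d) ℂ => (u : Matrix (Fin d) (Fin d) ℂ))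
        (hU a b).inv_right
    have h3 : ∀ a b, Commute (star (U a : Matrix (Fin d) (Fin d) ℂ))
        (star (U b : Matrix (Fin d) (Fin d) ℂ)) := fun a b => (h1 a b).star_star
    rintro ⟨a, _ | _⟩ ⟨b, _ | _⟩
    all_goals simp only [H, if_true, if_false, Bool.false_eq_true]
    · exact ((((h1 a b).sub_right (h2 a b)).sub_left
        ((h2 b a).symm.sub_right (h3 a b))).smul_left _).smul_right _
    · exact (((h1 a b).add_right (h2 a b)).sub_left
        ((h2 b a).symm.add_right (h3 a b))).smul_left _
    · exact (((h1 a b).sub_right (h2 a b)).add_left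
        ((h2 b a).symm.sub_right (h3 a b))).smul_right _
    · exact ((h1 a b).add_right (h2 a b)).add_left ((h2 b a).symm.add_right (h3 a b))
  have hTcomm : Pairwise (Function.onFun Commute T) := fun p q _ => by
    have := congrArg Matrix.toEuclideanLin (hcomm p q).eq
    rw [Matrix.toLpLin_mul_same, Matrix.toLpLin_mul_same] at this
    exact this
  have hint := LinearMap.IsSymmetric.directSum_isInternal_of_pairwise_commute hT hTcomm
  have horth := LinearMap.IsSymmetric.orthogonalFamily_iInf_eigenspaces hT
  -- A subordinate basis needs a finite index type; all but finitely many joint eigenspaces vanish.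
  have hint' := DirectSum.isInternal_ne_bot_iff.2 hint
  have : Finite {χ : α × Bool → ℂ | (⨅ p, Module.End.eigenspace (T p) (χ p)) ≠ ⊥} :=
    WellFoundedGT.finite_ne_bot_of_iSupIndep hint.submodule_iSupIndep
  have : Fintype {χ : α × Bool → ℂ // (⨅ p, Module.End.eigenspace (T p) (χ p)) ≠ ⊥} :=
    Fintype.ofFinite {χ : α × Bool → ℂ | (⨅ p, Module.End.eigenspace (T p) (χ p)) ≠ ⊥}
  have hdim : Module.finrank ℂ (EuclideanSpace ℂ (Fin d)) = d := by simp
  have horth' := horth.comp (Subtype.val_injective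
    (p := fun χ : α × Bool → ℂ => (⨅ p, Module.End.eigenspace (T p) (χ p)) ≠ ⊥))
  let e := hint'.subordinateOrthonormalBasis hdim horth'
  let χ : Fin d → α × Bool → ℂ := fun i => (hint'.subordinateOrthonormalBasisIndex hdim i horth').1
  have he : ∀ i p, T p (e i) = χ i p • e i := by
    intro i p
    have h := hint'.subordinateOrthonormalBasis_subordinate hdim i horth'
    exact Module.End.mem_eigenspace_iff.1 ((Submodule.mem_iInf _).1 h p)
  let b := EuclideanSpace.basisFun (Fin d) ℂ
  let V : Matrix.unitaryGroup (Fin d) ℂ :=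
    ⟨b.toBasis.toMatrix e, b.toMatrix_orthonormalBasis_mem_unitary e⟩
  have hV : ∀ i j, (V : Matrix (Fin d) (Fin d) ℂ) i j = e j i := by
    intro i j
    simp [V, b, Module.Basis.toMatrix_apply]
  refine ⟨V, fun a => ?_⟩
  let c : Fin d → ℂ := fun i => (χ i (a, true) - Complex.I * χ i (a, false)) / 2
  have hmul : (U a : Matrix (Fin d) (Fin d) ℂ) * V = V * Matrix.diagonal c := by
    have hUa : (U a : Matrix (Fin d) (Fin d) ℂ) =
        (1 / 2 : ℂ) • (H (a, true) - Complex.I • H (a, false)) := by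
      simp only [H, if_true, if_false, Bool.false_eq_true, smul_smul, Complex.I_mul_I]
      module
    ext i j
    have h1 : ∀ p, (H p * (V : Matrix (Fin d) (Fin d) ℂ)) i j = χ j p * e j i := by
      intro p
      have := congrArg (fun x : EuclideanSpace ℂ (Fin d) => x i) (he j p)
      simp only [T, Matrix.toLpLin_apply, PiLp.smul_apply, smul_eq_mul] at this
      rw [← this, Matrix.mul_apply]
      simp [Matrix.mulVec, dotProduct, hV]
    rw [hUa, Matrix.mul_diagonal, Matrix.smul_mul, Matrix.sub_mul, Matrix.smul_mul]
    simp only [Matrix.smul_apply, Matrix.sub_apply, h1, hV, smul_eq_mul, c]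
    ring
  refine ⟨c, fun i => ?_, hmul⟩
  have hD : Matrix.diagonal c = ((V⁻¹ * U a * V : Matrix.unitaryGroup (Fin d) ℂ) :
      Matrix (Fin d) (Fin d) ℂ) := by
    have : ((V⁻¹ * (U a * V) : Matrix.unitaryGroup (Fin d) ℂ) : Matrix (Fin d) (Fin d) ℂ) =
        star (V : Matrix (Fin d) (Fin d) ℂ) * ((U a : Matrix (Fin d) (Fin d) ℂ) * V) := rfl
    rw [mul_assoc, this, hmul, ← mul_assoc, Unitary.star_mul_self_of_mem V.2, one_mul]
  have hD' : Matrix.diagonal c * star (Matrix.diagonal c) = 1 := by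
    rw [hD]
    exact Unitary.mul_star_self_of_mem (Subtype.property _)
  have h := congrFun (congrFun hD' i) i
  rw [Matrix.star_eq_conjTranspose, Matrix.diagonal_conjTranspose, Matrix.diagonal_mul_diagonal,
    Matrix.diagonal_apply_eq, Matrix.one_apply_eq, Pi.star_apply, RCLike.star_def,
    Complex.mul_conj'] at h
  have h2 : ‖c i‖ ^ 2 = 1 := by exact_mod_cast h
  exact (pow_eq_one_iff_of_nonneg (norm_nonneg _) two_ne_zero).1 h2

/-- If `V` diagonalizes `π` on `Γ` and `W` is the value of `π` at the representative of the coset of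
`t`, then `tr (M π(t)) = ∑ i, c i * (V⁻¹ M W V) i i` with unimodular `c i`. The linear forms
`M ↦ (V⁻¹ M W V) i i` depend on the coset only, and are orthonormal in `i`. -/
theorem exists_orthonormal_norm_trace_le {G : Type*} [Group G] (Γ : Subgroup G)
    (hΓ : ∀ a ∈ Γ, ∀ b ∈ Γ, a * b = b * a) {d : ℕ} (π : G →* Matrix.unitaryGroup (Fin d) ℂ) :
    ∃ a : G ⧸ Γ → Fin d → Fin d × Fin d → ℂ,
      (∀ q i j, ∑ p, a q i p * star (a q j p) = if i = j then 1 else 0) ∧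
      ∀ (M : Matrix (Fin d) (Fin d) ℂ) (t : G),
        ‖(M * (π t : Matrix (Fin d) (Fin d) ℂ)).trace‖ ≤
          ∑ i, ‖∑ p, a (t : G ⧸ Γ) i p * M p.1 p.2‖ := by
  obtain ⟨V, hV⟩ := exists_unitary_diagonalizing (fun x : Γ => π x) fun x y => by
    rw [Commute, SemiconjBy, ← map_mul, ← map_mul, hΓ x x.2 y y.2]
  let Q : G ⧸ Γ → Matrix.unitaryGroup (Fin d) ℂ := fun q => π q.out * V
  have hcol : ∀ (X : Matrix.unitaryGroup (Fin d) ℂ) (i j : Fin d),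
      ∑ r, star (X.1 r i) * X.1 r j = if i = j then 1 else 0 := by
    intro X i j
    have h : star (X : Matrix (Fin d) (Fin d) ℂ) * X = 1 := Unitary.star_mul_self_of_mem X.2
    simpa [Matrix.mul_apply, Matrix.one_apply] using congrFun (congrFun h i) j
  refine ⟨fun q i p => star (V.1 p.1 i) * (Q q).1 p.2 i, fun q i j => ?_, fun M t => ?_⟩
  · have hprod : ∀ p : Fin d × Fin d,
        star (V.1 p.1 i) * (Q q).1 p.2 i * star (star (V.1 p.1 j) * (Q q).1 p.2 j) =
          (star (V.1 p.1 i) * V.1 p.1 j) * (star ((Q q).1 p.2 j) * (Q q).1 p.2 i) := by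
      intro p
      rw [star_mul', star_star]
      ring
    simp_rw [hprod]
    rw [Fintype.sum_prod_type]
    refine (Fintype.sum_mul_sum (fun r => star (V.1 r i) * V.1 r j)
      (fun s => star ((Q q).1 s j) * (Q q).1 s i)).symm.trans ?_
    rw [hcol, hcol]
    by_cases h : i = j <;> simp [h]
  · obtain ⟨γ, hγ⟩ := QuotientGroup.mk_out_eq_mul Γ t
    obtain ⟨c, hc, hcV⟩ := hV γ⁻¹
    have ht : π t = π (t : G ⧸ Γ).out * π ((γ⁻¹ : Γ) : G) := by
      rw [← map_mul, hγ]
      simp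
    have htr : (M * (π t : Matrix (Fin d) (Fin d) ℂ)).trace =
        ∑ i, (∑ p : Fin d × Fin d, star (V.1 p.1 i) * (Q (t : G ⧸ Γ)).1 p.2 i * M p.1 p.2) *
          c i := by
      have h1 : (π t : Matrix (Fin d) (Fin d) ℂ) * V.1 =
          (Q (t : G ⧸ Γ)).1 * Matrix.diagonal c := by
        calc (π t : Matrix (Fin d) (Fin d) ℂ) * V.1
            = (π (t : G ⧸ Γ).out).1 * ((π ((γ⁻¹ : Γ) : G)).1 * V.1) := by
              rw [ht, Submonoid.coe_mul, mul_assoc]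
          _ = (Q (t : G ⧸ Γ)).1 * Matrix.diagonal c := by
              rw [hcV, ← mul_assoc]
              rfl
      have h2 : M * (π t : Matrix (Fin d) (Fin d) ℂ) =
          (M * ((Q (t : G ⧸ Γ)).1 * Matrix.diagonal c)) * star V.1 := by
        rw [← h1, mul_assoc, mul_assoc, Unitary.mul_star_self_of_mem V.2, mul_one]
      rw [h2, Matrix.trace_mul_comm, ← mul_assoc, ← mul_assoc]
      simp only [Matrix.trace, Matrix.diag, Matrix.mul_diagonal]
      refine Finset.sum_congr rfl fun i _ => ?_
      congr 1
      rw [Fintype.sum_prod_type, Finset.sum_comm, Matrix.mul_apply]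
      refine Finset.sum_congr rfl fun s _ => ?_
      rw [Matrix.mul_apply, Finset.sum_mul]
      refine Finset.sum_congr rfl fun r _ => ?_
      rw [Matrix.star_apply]
      ring
    rw [htr]
    refine (norm_sum_le _ _).trans (le_of_eq ?_)
    simp [hc]

/-! ### The expected supremum -/

theorem mainTheorem7 {G : Type*} [Group G] (Γ : Subgroup G)
    (hΓ : ∀ a ∈ Γ, ∀ b ∈ Γ, a * b = b * a)
    (k : ℕ) (hk : k ≠ 0) (hindex : Γ.index = k)
    (d : ℕ) (π : G →* Matrix.unitaryGroup (Fin d) ℂ)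
    {Ω : Type*} [MeasurableSpace Ω] (P : Measure Ω) [IsProbabilityMeasure P]
    (g : Ω → Matrix (Fin d) (Fin d) ℂ) (hg : IsNormalizedGaussianMatrix P d g) :
    (∀ ω, BddAbove (Set.range fun t : G =>
        ‖(g ω * (π t : Matrix (Fin d) (Fin d) ℂ)).trace‖)) ∧
    Integrable (fun ω => ⨆ t : G, ‖(g ω * (π t : Matrix (Fin d) (Fin d) ℂ)).trace‖) P ∧
    ∫ ω, ⨆ t : G, ‖(g ω * (π t : Matrix (Fin d) (Fin d) ℂ)).trace‖ ∂P
      ≤ √(2 * Real.log k) + √(d : ℝ) := by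
  obtain ⟨a, ha, hle⟩ := exists_orthonormal_norm_trace_le Γ hΓ π
  have hcard : Nat.card (G ⧸ Γ) = k := hindex
  have : Finite (G ⧸ Γ) := Nat.finite_of_card_ne_zero (hcard ▸ hk)
  have := Fintype.ofFinite (G ⧸ Γ)
  rw [Nat.card_eq_fintype_card] at hcard
  rcases Nat.eq_zero_or_pos d with rfl | hd
  · simp [Matrix.trace]
  have hd' : (0 : ℝ) < d := by exact_mod_cast hd
  set v : ℝ≥0 := 1 / (d : ℝ≥0) with hvdef
  have hv : v ≠ 0 := by positivity
  have hvd : (d : ℝ) * v = 1 := by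
    rw [hvdef]
    push_cast
    field_simp
  have hvs : (d : ℝ) * √v = √d := by
    have : (v : ℝ) = (d : ℝ)⁻¹ := by simp [hvdef]
    rw [this, Real.sqrt_inv, ← div_eq_mul_inv, Real.div_sqrt]
  let Y : G ⧸ Γ → Ω → Fin d → ℂ := fun q ω i => ∑ p, a q i p * g ω p.1 p.2
  have hY : ∀ q, HasLaw (Y q) (Measure.pi fun _ => complexGaussian v) P := fun q =>
    hasLaw_pi_complexGaussian_of_orthonormal hg.indep (fun p => hg.law p.1 p.2) (ha q)
  -- Exponential moments of the diagonal sums, uniformly over the cosets.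
  have hexp : ∀ l : ℝ, 0 ≤ l → ∀ q,
      Integrable (fun ω => Real.exp (l * ∑ i, ‖Y q ω i‖)) P ∧
        ∫ ω, Real.exp (l * ∑ i, ‖Y q ω i‖) ∂P ≤ Real.exp (l * √d + l ^ 2 / 2) := by
    intro l hl q
    obtain ⟨h1, h2⟩ := exp_sum_norm_pi_complexGaussian (ι := Fin d) hv hl
    have e : (Fintype.card (Fin d) : ℝ) * (l * √v + l ^ 2 * v / 2) = l * √d + l ^ 2 / 2 := by
      rw [Fintype.card_fin]
      linear_combination l * hvs + l ^ 2 / 2 * hvd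
    rw [e] at h2
    rw [← (hY q).map_eq] at h1 h2
    rw [integral_map (hY q).aemeasurable h1.aestronglyMeasurable] at h2
    exact ⟨h1.comp_aemeasurable (hY q).aemeasurable, h2⟩
  have hbdd : ∀ M : Matrix (Fin d) (Fin d) ℂ, BddAbove (Set.range fun t : G =>
      ‖(M * (π t : Matrix (Fin d) (Fin d) ℂ)).trace‖) := by
    intro M
    refine ⟨∑ q : G ⧸ Γ, ∑ i, ‖∑ p, a q i p * M p.1 p.2‖, ?_⟩
    rintro _ ⟨t, rfl⟩
    exact (hle M t).trans (Finset.single_le_sum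
      (f := fun q => ∑ i, ‖∑ p, a q i p * M p.1 p.2‖) (fun q _ => by positivity)
      (Finset.mem_univ (t : G ⧸ Γ)))
  set S : Ω → ℝ := fun ω => ⨆ t : G, ‖(g ω * (π t : Matrix (Fin d) (Fin d) ℂ)).trace‖ with hS
  have hSle : ∀ ω, ∃ q, S ω ≤ ∑ i, ‖Y q ω i‖ := by
    intro ω
    obtain ⟨q, hq⟩ := Finite.exists_max fun q => ∑ i, ‖Y q ω i‖
    exact ⟨q, ciSup_le fun t => (hle (g ω) t).trans (hq t)⟩
  have hSnonneg : ∀ ω, 0 ≤ S ω := fun ω => Real.iSup_nonneg fun t => norm_nonneg _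
  -- `G` may be uncountable: measurability comes from lower semicontinuity of the supremum in the
  -- matrix entries.
  have hSmeas : AEMeasurable S P := by
    have hlsc : LowerSemicontinuous fun z : Fin d × Fin d → ℂ =>
        ⨆ t : G, ‖(Matrix.of (fun i j => z (i, j)) *
          (π t : Matrix (Fin d) (Fin d) ℂ)).trace‖ := by
      refine lowerSemicontinuous_ciSup (fun z => hbdd _) fun t => Continuous.lowerSemicontinuous ?_
      simp only [Matrix.trace, Matrix.diag, Matrix.mul_apply, Matrix.of_apply]
      fun_prop
    have hgm : AEMeasurable (fun ω (p : Fin d × Fin d) => g ω p.1 p.2) P :=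
      aemeasurable_pi_lambda _ fun p => (hg.law p.1 p.2).aemeasurable
    have hof : ∀ ω, Matrix.of (fun i j => g ω i j) = g ω := fun ω => rfl
    have h := hlsc.measurable.comp_aemeasurable hgm
    simp only [Function.comp_def, hof] at h
    exact h
  have hSint : Integrable S P := by
    refine (integrable_finsetSum (Finset.univ : Finset (G ⧸ Γ)) fun q _ =>
      (hexp 1 zero_le_one q).1).mono' hSmeas.aestronglyMeasurable (ae_of_all _ fun ω => ?_)
    obtain ⟨q, hq⟩ := hSle ω
    rw [Real.norm_of_nonneg (hSnonneg ω)]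
    have h1 := Real.add_one_le_exp (1 * ∑ i, ‖Y q ω i‖)
    have h2 := Finset.single_le_sum (f := fun q => Real.exp (1 * ∑ i, ‖Y q ω i‖))
      (fun q _ => (Real.exp_pos _).le) (Finset.mem_univ q)
    linarith
  have hmain : ∀ l : ℝ, 0 < l → l * ∫ ω, S ω ∂P ≤ Real.log k + (l * √d + l ^ 2 / 2) := by
    intro l hl
    have h := mul_integral_le_log_card_add (l := l) (F := fun q ω => l * ∑ i, ‖Y q ω i‖) hSint
      (fun ω => (hSle ω).imp fun q hq => mul_le_mul_of_nonneg_left hq hl.le)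
      (fun q => (hexp l hl.le q).1) (fun q => (hexp l hl.le q).2)
    rwa [hcard] at h
  exact ⟨fun ω => hbdd (g ω), hSint,
    le_sqrt_two_mul_add_of_forall_mul_le (Real.log_natCast_nonneg k) hmain⟩
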